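/- An ordered graph is a finite simple graph together with a linear order on its vertex set; two ordered graphs are isomorphic if there is an order-preserving bijection between their vertex sets that preserves both adjacency and non-adjacency. A hereditary property of ordered graphs is a collection $\mathcal{P}$ of ordered graphs closed under isomorphism and under taking induced subgraphs (with the induced order). Write $|\mathcal{P}_n|$ for the number of isomorphism classes of members of $\mathcal{P}$ with exactly $n$ vertices, and $e(G)$ for the number of edges of $G$. Let $\mathcal{P}$ be a hereditary property of ordered graphs, and suppose that there is a function $f:\mathbb{N}\to\mathbb{N}$ with $f(n)=o(n^2)$ such that $e(G)\leq f(n)$ for every $n\in\mathbb{N}$ and every $G\in\mathcal{P}$ with $n$ vertices. If for every constant $c>0$ there exists an $N=N(c)\in\mathbb{N}$ such that $|\mathcal{P}_N|>c^N$, then $$|\mathcal{P}_n|\;\geq\;\sum_{k=0}^{\lfloor n/2\rfloor}\binom{n}{2k}\,k!\qquad\text{for every } n\in\mathbb{N},$$ and moreover $$\sum_{k=0}^{\lfloor n/2\rfloor}\binom{n}{2k}\,k! \;=\; n^{n/2+o(n)}.$$ -/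

import Mathlib

open Filter Asymptotics

/-- A (finite) ordered graph: a simple graph together with a linear order on its vertices. -/
structure OrderedGraph where
  V : Type
  [finite : Finite V]
  [order : LinearOrder V]
  graph : SimpleGraph V

attribute [instance] OrderedGraph.finite OrderedGraph.order

namespace OrderedGraph

/-- The number of vertices of `G`. -/
noncomputable def numVertices (G : OrderedGraph) : ℕ := Nat.card G.V

/-- The number of edges `e(G)` of `G`. -/
noncomputable def numEdges (G : OrderedGraph) : ℕ := G.graph.edgeSet.ncard

/-- Isomorphism of ordered graphs: an order isomorphism of the vertex sets which preserves
adjacency and non-adjacency. -/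
def IsIsomorphic (G H : OrderedGraph) : Prop :=
  ∃ φ : G.V ≃o H.V, ∀ x y : G.V, H.graph.Adj (φ x) (φ y) ↔ G.graph.Adj x y

/-- The ordered subgraph of `G` induced by the vertex set `U`, with the induced order. -/
def induce (G : OrderedGraph) (U : Set G.V) : OrderedGraph where
  V := U
  graph := G.graph.induce U

theorem isIsomorphic_equivalence : Equivalence IsIsomorphic where
  refl _ := ⟨OrderIso.refl _, fun _ _ => Iff.rfl⟩
  symm := by
    rintro G H ⟨φ, h⟩
    refine ⟨φ.symm, fun x y => ?_⟩
    simpa using (h (φ.symm x) (φ.symm y)).symm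
  trans := by
    rintro G H K ⟨φ, h⟩ ⟨ψ, k⟩
    exact ⟨φ.trans ψ, fun x y => (k (φ x) (φ y)).trans (h x y)⟩

/-- Isomorphism as an equivalence relation on ordered graphs. -/
def isoSetoid : Setoid OrderedGraph := ⟨IsIsomorphic, isIsomorphic_equivalence⟩

/-- A property of ordered graphs: a collection closed under isomorphism. -/
def IsProperty (P : Set OrderedGraph) : Prop :=
  ∀ G H : OrderedGraph, IsIsomorphic G H → G ∈ P → H ∈ P

/-- A hereditary property: a property closed under taking induced ordered subgraphs. -/
def IsHereditary (P : Set OrderedGraph) : Prop :=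
  IsProperty P ∧ ∀ G ∈ P, ∀ U : Set G.V, G.induce U ∈ P

/-- The speed `|P_n|`: the number of isomorphism classes of ordered graphs on `n` vertices
in `P` (there are only finitely many such classes). -/
noncomputable def speed (P : Set OrderedGraph) (n : ℕ) : ℕ :=
  (Quotient.mk isoSetoid '' {G : OrderedGraph | G ∈ P ∧ G.numVertices = n}).ncard

/-- The function `∑_{k = 0}^{⌊n/2⌋} (n choose 2k) k!`. -/
def factorialSpeed (n : ℕ) : ℕ :=
  ∑ k ∈ Finset.range (n / 2 + 1), n.choose (2 * k) * k.factorial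

end OrderedGraph

/-! Record an ordered graph by the cells above the diagonal of its adjacency matrix; isomorphism
classes then become distinct subsets of a grid. By Marcus–Tardos and Klazar
(`exists_card_avoiders_le_pow`), at most c^n subsets of the n × n grid avoid a given permutation
pattern, so superexponential speed forces every permutation pattern to occur in the cells of some
member of P.

An occurrence only yields a subgraph; sparsity makes it induced. Replace each edge of the matching
of σ by L parallel copies, so that every vertex becomes a cluster of L vertices. Two clusters span
at most f(2L) = o(L²) edges, so for a suitable L a random choice of one copy per edge leaves, with
positive probability, no edge besides the matching (`matchingGraph_mem_of_blowup`). Hence P contains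
every `matchingGraph σ`.

Any 2k of n vertices, with a bijection from their lower half to their upper half, give a graph
induced in a matching graph on 2n vertices. Distinct choices give distinct graphs, which accounts
for the terms (n choose 2k) k!. The asymptotics follow because the sum lies between ⌊n/2⌋! and 2^n
⌊n/2⌋!. -/

/-! ### Permutation patterns in finite sets of cells -/

/-- The set of cells `A ⊆ ℕ × ℕ` contains the permutation pattern `π`. -/
def ContainsPattern {α β : Type*} [Preorder α] [Preorder β] (π : α ≃ β)
    (A : Finset (ℕ × ℕ)) : Prop :=
  ∃ (r : α → ℕ) (c : β → ℕ), StrictMono r ∧ StrictMono c ∧ ∀ a, (r a, c (π a)) ∈ A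

/-- The set of `s × s` blocks that meet `A`. -/
def contract (s : ℕ) (A : Finset (ℕ × ℕ)) : Finset (ℕ × ℕ) :=
  A.image fun p => (p.1 / s, p.2 / s)

/-- The part of `A` in the `s × s` block with index `b`. -/
def block (s : ℕ) (A : Finset (ℕ × ℕ)) (b : ℕ × ℕ) : Finset (ℕ × ℕ) :=
  A.filter fun p => (p.1 / s, p.2 / s) = b

theorem lt_of_div_lt_div {s a b : ℕ} (h : a / s < b / s) : a < b :=
  lt_of_not_ge fun hba => absurd (Nat.div_le_div_right hba) (not_le.2 h)

theorem mem_Ico_of_div_eq {s x q : ℕ} (hs : 0 < s) (h : x / s = q) :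
    x ∈ Finset.Ico (q * s) (q * s + s) := by
  subst h
  rw [Finset.mem_Ico]
  exact ⟨Nat.div_mul_le_self x s, Nat.lt_div_mul_add hs⟩

theorem exists_strictMono_mem {α : Type*} [LinearOrder α] [Fintype α] (S : Finset ℕ)
    (h : Fintype.card α ≤ S.card) : ∃ r : α → ℕ, StrictMono r ∧ ∀ a, r a ∈ S :=
  ⟨fun a => S.orderEmbOfCardLe h ((Fintype.orderIsoFinOfCardEq α rfl).symm a),
    (S.orderEmbOfCardLe h).strictMono.comp (Fintype.orderIsoFinOfCardEq α rfl).symm.strictMono,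
    fun _ => S.orderEmbOfCardLe_mem h _⟩

theorem contract_subset {s n : ℕ} {A : Finset (ℕ × ℕ)}
    (hA : A ⊆ Finset.range (s * n) ×ˢ Finset.range (s * n)) :
    contract s A ⊆ Finset.range n ×ˢ Finset.range n := by
  intro b hb
  obtain ⟨p, hp, rfl⟩ := Finset.mem_image.1 hb
  have h := hA hp
  simp only [Finset.mem_product, Finset.mem_range] at h ⊢
  exact ⟨Nat.div_lt_of_lt_mul h.1, Nat.div_lt_of_lt_mul h.2⟩

theorem ContainsPattern.swap {α β : Type*} [Preorder α] [Preorder β] {π : α ≃ β}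
    {A : Finset (ℕ × ℕ)} (h : ContainsPattern π.symm (A.image Prod.swap)) :
    ContainsPattern π A := by
  obtain ⟨r, c, hr, hc, h⟩ := h
  refine ⟨c, r, hc, hr, fun a => ?_⟩
  obtain ⟨p, hp, hpe⟩ := Finset.mem_image.1 (h (π a))
  rw [π.symm_apply_apply] at hpe
  rw [← Prod.swap_swap p, hpe] at hp
  exact hp

/-- A permutation pattern uses each block row and each block column at most once, so any one cell of
`A` from each block used is ordered as the blocks are. -/
theorem ContainsPattern.of_contract {α β : Type*} [Preorder α] [Preorder β] {π : α ≃ β}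
    {s : ℕ} {A : Finset (ℕ × ℕ)} (h : ContainsPattern π (contract s A)) :
    ContainsPattern π A := by
  obtain ⟨r, c, hr, hc, h⟩ := h
  choose p hpA hp using fun a => Finset.mem_image.1 (h a)
  simp only [Prod.mk.injEq] at hp
  refine ⟨fun a => (p a).1, fun b => (p (π.symm b)).2, fun a a' haa' => ?_,
    fun b b' hbb' => ?_, fun a => ?_⟩
  · apply lt_of_div_lt_div (s := s)
    rw [(hp a).1, (hp a').1]
    exact hr haa'
  · apply lt_of_div_lt_div (s := s)
    rw [(hp _).2, (hp _).2, π.apply_symm_apply, π.apply_symm_apply]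
    exact hc hbb'
  · simpa using hpA a

/-- The subsets of the `n × n` grid that do not contain the pattern `π`. -/
noncomputable def avoiders {α β : Type*} [Preorder α] [Preorder β] (π : α ≃ β) (n : ℕ) :
    Finset (Finset (ℕ × ℕ)) :=
  open scoped Classical in
  (Finset.range n ×ˢ Finset.range n).powerset.filter fun A => ¬ ContainsPattern π A

theorem mem_avoiders {α β : Type*} [Preorder α] [Preorder β] {π : α ≃ β} {n : ℕ}
    {A : Finset (ℕ × ℕ)} :
    A ∈ avoiders π n ↔ A ⊆ Finset.range n ×ˢ Finset.range n ∧ ¬ ContainsPattern π A := by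
  simp [avoiders]

theorem card_avoiders_le {α β : Type*} [Preorder α] [Preorder β] (π : α ≃ β) (n : ℕ) :
    (avoiders π n).card ≤ 2 ^ (n * n) := by
  refine (Finset.card_le_card (t := (Finset.range n ×ˢ Finset.range n).powerset)
    fun A hA => Finset.mem_powerset.2 (mem_avoiders.1 hA).1).trans_eq ?_
  rw [Finset.card_powerset, Finset.card_product, Finset.card_range]

/-! ### The Marcus–Tardos theorem -/

section MarcusTardos

variable {α β : Type*} [LinearOrder α] [LinearOrder β] [Fintype α] [Fintype β]

/-- Pigeonhole on the set of columns a block occupies, one of 2^s subsets: otherwise more than k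
blocks, stacked in different block rows, occupy the same set of at least k columns. Each block can
then supply whichever column π prescribes for its row. -/
theorem card_wide_in_column_le {π : α ≃ β} {s : ℕ} (hs : 0 < s) {A : Finset (ℕ × ℕ)}
    (hA : ¬ ContainsPattern π A) (J : ℕ) :
    ((((contract s A).filter fun b =>
      Fintype.card α ≤ ((block s A b).image Prod.snd).card)).filter fun b => b.2 = J).card
      ≤ Fintype.card α * 2 ^ s := by
  set W := ((contract s A).filter fun b =>
      Fintype.card α ≤ ((block s A b).image Prod.snd).card).filter fun b => b.2 = J with hW
  by_contra! hcard
  have hmaps : ∀ b ∈ W, (block s A b).image Prod.snd ∈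
      (Finset.Ico (J * s) (J * s + s)).powerset := by
    intro b hb
    have hbJ : b.2 = J := (Finset.mem_filter.1 hb).2
    rw [Finset.mem_powerset]
    intro x hx
    obtain ⟨p, hp, rfl⟩ := Finset.mem_image.1 hx
    have := (Finset.mem_filter.1 hp).2
    exact mem_Ico_of_div_eq hs (by rw [← hbJ, ← this])
  obtain ⟨S, -, hS⟩ := Finset.exists_lt_card_fiber_of_mul_lt_card_of_maps_to
    (n := Fintype.card α) hmaps (by
      rw [Finset.card_powerset, Nat.card_Ico, Nat.add_sub_cancel_left, mul_comm]
      exact hcard)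
  set F := W.filter fun b => (block s A b).image Prod.snd = S with hF
  have hSk : Fintype.card β ≤ S.card := by
    obtain ⟨b, hb⟩ := Finset.card_pos.1 (lt_of_le_of_lt (Nat.zero_le _) hS)
    obtain ⟨hbW, rfl⟩ := Finset.mem_filter.1 hb
    rw [← Fintype.card_congr π]
    exact (Finset.mem_filter.1 (Finset.mem_filter.1 hbW).1).2
  have hinj : Set.InjOn Prod.fst (F : Set (ℕ × ℕ)) := by
    intro b hb b' hb' h
    have h1 := (Finset.mem_filter.1 (Finset.mem_filter.1 hb).1).2
    have h2 := (Finset.mem_filter.1 (Finset.mem_filter.1 hb').1).2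
    exact Prod.ext h (h1.trans h2.symm)
  obtain ⟨r, hr, hrF⟩ := exists_strictMono_mem (α := α) (F.image Prod.fst)
    (by rw [Finset.card_image_of_injOn hinj]; exact hS.le)
  obtain ⟨c, hc, hcS⟩ := exists_strictMono_mem (α := β) S hSk
  have key : ∀ a, ∃ p ∈ A, p.1 / s = r a ∧ p.2 = c (π a) := by
    intro a
    obtain ⟨b, hb, hba⟩ := Finset.mem_image.1 (hrF a)
    have hcm := hcS (π a)
    rw [← (Finset.mem_filter.1 hb).2] at hcm
    obtain ⟨p, hp, hpc⟩ := Finset.mem_image.1 hcm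
    obtain ⟨hpA, hpb⟩ := Finset.mem_filter.1 hp
    exact ⟨p, hpA, by rw [← hba, ← hpb], hpc⟩
  choose p hpA hpr hpc using key
  refine hA ⟨fun a => (p a).1, c, fun a a' h => ?_, hc, fun a => ?_⟩
  · apply lt_of_div_lt_div (s := s)
    rw [hpr, hpr]
    exact hr h
  · rw [← hpc]
    exact hpA a

theorem card_wide_le {π : α ≃ β} {s n : ℕ} (hs : 0 < s) {A : Finset (ℕ × ℕ)}
    (hA : ¬ ContainsPattern π A)
    (hAn : A ⊆ Finset.range (s * n) ×ˢ Finset.range (s * n)) :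
    ((contract s A).filter fun b =>
      Fintype.card α ≤ ((block s A b).image Prod.snd).card).card
      ≤ Fintype.card α * 2 ^ s * n := by
  have := Finset.card_le_mul_card_image_of_maps_to (f := Prod.snd) (t := Finset.range n)
    (fun b hb => (Finset.mem_product.1
      (contract_subset hAn (Finset.mem_filter.1 hb).1)).2) _
    (fun J _ => card_wide_in_column_le hs hA J)
  rwa [Finset.card_range] at this

theorem block_swap (s : ℕ) (A : Finset (ℕ × ℕ)) (b : ℕ × ℕ) :
    (block s (A.image Prod.swap) b.swap).image Prod.snd = (block s A b).image Prod.fst := by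
  ext x
  simp only [block, Finset.mem_image, Finset.mem_filter, Prod.exists, Prod.ext_iff,
    Prod.fst_swap, Prod.snd_swap]
  grind

theorem contract_swap (s : ℕ) (A : Finset (ℕ × ℕ)) :
    contract s (A.image Prod.swap) = (contract s A).image Prod.swap := by
  simp only [contract, Finset.image_image]
  rfl

/-- Transposition exchanges rows with columns and π with its inverse. -/
theorem card_tall_le {π : α ≃ β} {s n : ℕ} (hs : 0 < s) {A : Finset (ℕ × ℕ)}
    (hA : ¬ ContainsPattern π A)
    (hAn : A ⊆ Finset.range (s * n) ×ˢ Finset.range (s * n)) :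
    ((contract s A).filter fun b =>
      Fintype.card α ≤ ((block s A b).image Prod.fst).card).card
      ≤ Fintype.card α * 2 ^ s * n := by
  have h := card_wide_le (π := π.symm) (s := s) (n := n) hs (A := A.image Prod.swap)
    (fun h => hA h.swap) (by
      intro p hp
      obtain ⟨q, hq, rfl⟩ := Finset.mem_image.1 hp
      have := Finset.mem_product.1 (hAn hq)
      exact Finset.mem_product.2 ⟨this.2, this.1⟩)
  rw [← Fintype.card_congr π] at h
  refine le_trans (Finset.card_le_card_of_injOn Prod.swap (fun b hb => ?_)
    Prod.swap_injective.injOn) h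
  obtain ⟨hb1, hb2⟩ := Finset.mem_filter.1 hb
  refine Finset.mem_coe.2 (Finset.mem_filter.2 ⟨?_, ?_⟩)
  · rw [contract_swap]
    exact Finset.mem_image_of_mem _ hb1
  · rwa [block_swap]

theorem card_block_le (s : ℕ) (A : Finset (ℕ × ℕ)) (b : ℕ × ℕ) :
    (block s A b).card ≤
      ((block s A b).image Prod.fst).card * ((block s A b).image Prod.snd).card := by
  rw [← Finset.card_product]
  refine Finset.card_le_card fun p hp => ?_
  exact Finset.mem_product.2 ⟨Finset.mem_image_of_mem _ hp, Finset.mem_image_of_mem _ hp⟩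

theorem card_block_le_sq {s : ℕ} (hs : 0 < s) (A : Finset (ℕ × ℕ)) (b : ℕ × ℕ) :
    (block s A b).card ≤ s * s := by
  have : block s A b ⊆ Finset.Ico (b.1 * s) (b.1 * s + s) ×ˢ
      Finset.Ico (b.2 * s) (b.2 * s + s) := by
    intro p hp
    have h := (Finset.mem_filter.1 hp).2
    exact Finset.mem_product.2 ⟨mem_Ico_of_div_eq hs (by rw [← h]),
      mem_Ico_of_div_eq hs (by rw [← h])⟩
  simpa using Finset.card_le_card this

/-- A block that is neither wide nor tall has fewer than k rows and fewer than k columns in use,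
hence at most k² cells. The few wide or tall blocks are charged their full s² cells. -/
theorem card_le_of_not_containsPattern {π : α ≃ β} {s n : ℕ} (hs : 0 < s)
    {A : Finset (ℕ × ℕ)} (hA : ¬ ContainsPattern π A)
    (hAn : A ⊆ Finset.range (s * n) ×ˢ Finset.range (s * n)) :
    A.card ≤ Fintype.card α * Fintype.card α * (contract s A).card
      + 2 * (s * s * (Fintype.card α * 2 ^ s * n)) := by
  set k := Fintype.card α with hk
  have h1 : ∀ b ∈ contract s A, (block s A b).card ≤ k * k
      + ((if k ≤ ((block s A b).image Prod.snd).card then s * s else 0)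
      + (if k ≤ ((block s A b).image Prod.fst).card then s * s else 0)) := by
    intro b _
    have h2 := card_block_le s A b
    have h3 := card_block_le_sq hs A b
    split_ifs with hw ht ht
    · omega
    · omega
    · omega
    · exact h2.trans ((Nat.mul_le_mul (not_le.1 ht).le (not_le.1 hw).le).trans (by omega))
  calc A.card = ∑ b ∈ contract s A, (block s A b).card :=
        Finset.card_eq_sum_card_image (fun p : ℕ × ℕ => (p.1 / s, p.2 / s)) A
    _ ≤ _ := Finset.sum_le_sum h1
    _ = k * k * (contract s A).card
        + (s * s * ((contract s A).filter fun b =>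
            k ≤ ((block s A b).image Prod.snd).card).card
          + s * s * ((contract s A).filter fun b =>
            k ≤ ((block s A b).image Prod.fst).card).card) := by
        rw [Finset.sum_add_distrib, Finset.sum_add_distrib, Finset.sum_const,
          ← Finset.sum_filter, ← Finset.sum_filter, Finset.sum_const, Finset.sum_const]
        simp only [smul_eq_mul]
        ring
    _ ≤ _ := by
        have hw := Nat.mul_le_mul_left (s * s) (card_wide_le hs hA hAn)
        have ht := Nat.mul_le_mul_left (s * s) (card_tall_le hs hA hAn)
        rw [← hk] at hw ht
        omega

/-- **Marcus–Tardos**: a subset of an `n × n` grid without a given permutation pattern has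
linear size. -/
theorem exists_card_le_mul_of_not_containsPattern (π : α ≃ β) :
    ∃ C : ℕ, ∀ (n : ℕ) (A : Finset (ℕ × ℕ)), A ⊆ Finset.range n ×ˢ Finset.range n →
      ¬ ContainsPattern π A → A.card ≤ C * n := by
  set k := Fintype.card α with hk
  -- The recursion closes when s ≥ k² + 1; this choice also keeps s > 1 for k = 0.
  set s := (k + 2) * (k + 2) with hs
  have hs1 : 1 < s := by rw [hs]; nlinarith
  set E := 2 * (s * s * (k * 2 ^ s)) with hE
  have hpow : ∀ (j : ℕ) (A : Finset (ℕ × ℕ)),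
      A ⊆ Finset.range (s ^ j) ×ˢ Finset.range (s ^ j) →
      ¬ ContainsPattern π A → A.card ≤ (E + 1) * s ^ j := by
    intro j
    induction j with
    | zero =>
      intro A hA _
      have := Finset.card_le_card hA
      simp only [pow_zero, Finset.card_product, Finset.card_range] at this ⊢
      omega
    | succ j ih =>
      intro A hA hπ
      rw [pow_succ'] at hA ⊢
      have h1 := card_le_of_not_containsPattern (by omega) hπ hA
      have h2 := ih _ (contract_subset hA) (fun h => hπ h.of_contract)
      rw [← hk] at h1
      calc A.card ≤ _ := h1
        _ ≤ k * k * ((E + 1) * s ^ j) + E * s ^ j := by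
          have h3 := Nat.mul_le_mul_left (k * k) h2
          have h4 : 2 * (s * s * (k * 2 ^ s * s ^ j)) = E * s ^ j := by rw [hE]; ring
          omega
        _ ≤ (k * k + 1) * ((E + 1) * s ^ j) := by nlinarith [Nat.zero_le (s ^ j)]
        _ ≤ s * ((E + 1) * s ^ j) := Nat.mul_le_mul_right _ (by rw [hs]; nlinarith)
        _ = (E + 1) * (s * s ^ j) := by ring
  -- The extra factor s pays for rounding n up to a power of s.
  refine ⟨(E + 1) * s, fun n A hA hπ => ?_⟩
  rcases Nat.eq_zero_or_pos n with rfl | hn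
  · simpa using Finset.card_le_card hA
  · obtain ⟨j, hj1, hj2⟩ := exists_nat_pow_near hn hs1
    have hsub : Finset.range n ⊆ Finset.range (s ^ (j + 1)) := Finset.range_mono hj2.le
    refine (hpow (j + 1) A (hA.trans (Finset.product_subset_product hsub hsub)) hπ).trans ?_
    rw [pow_succ', mul_assoc (E + 1)]
    exact Nat.mul_le_mul_left _ (Nat.mul_le_mul_left _ hj1)

/-! ### From linear size to exponentially many avoiders. -/

theorem card_filter_contract_two_eq_le (T : Finset (Finset (ℕ × ℕ))) (B : Finset (ℕ × ℕ)) :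
    (T.filter fun A => contract 2 A = B).card ≤ 16 ^ B.card := by
  -- Every preimage of `B` lives in its 2 × 2 blocks: four cells, hence 2^4 = 16 fillings, per
  -- block.
  set U := B.biUnion fun b => Finset.Ico (b.1 * 2) (b.1 * 2 + 2) ×ˢ
    Finset.Ico (b.2 * 2) (b.2 * 2 + 2) with hU
  have hUc : U.card ≤ B.card * 4 := by
    refine Finset.card_biUnion_le_card_mul _ _ _ fun b _ => ?_
    simp
  have hsub : (T.filter fun A => contract 2 A = B) ⊆ U.powerset := by
    intro A hA
    obtain ⟨-, rfl⟩ := Finset.mem_filter.1 hA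
    refine Finset.mem_powerset.2 fun p hp => Finset.mem_biUnion.2
      ⟨_, Finset.mem_image_of_mem _ hp, Finset.mem_product.2
        ⟨mem_Ico_of_div_eq two_pos rfl, mem_Ico_of_div_eq two_pos rfl⟩⟩
  calc _ ≤ U.powerset.card := Finset.card_le_card hsub
    _ = 2 ^ U.card := Finset.card_powerset U
    _ ≤ 2 ^ (4 * B.card) := Nat.pow_le_pow_right two_pos (by omega)
    _ = 16 ^ B.card := by rw [pow_mul]; norm_num

/-- **Klazar**: there are at most exponentially many subsets of an `n × n` grid without a given
permutation pattern. -/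
theorem exists_card_avoiders_le_pow (π : α ≃ β) :
    ∃ c : ℕ, 0 < c ∧ ∀ n : ℕ, (avoiders π n).card ≤ c ^ n := by
  obtain ⟨C, hC⟩ := exists_card_le_mul_of_not_containsPattern π
  -- Contracting 2^(j+1) to 2^j costs a factor 16^(C 2^j), as the contraction still avoids π and so
  -- has at most C 2^j cells. These exponents form a geometric sum; the +1 covers the 1 × 1 grid.
  have hpow : ∀ j : ℕ, (avoiders π (2 ^ j)).card ≤ 16 ^ ((C + 1) * 2 ^ j) := by
    intro j
    induction j with
    | zero =>
      rw [pow_zero]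
      calc (avoiders π 1).card ≤ 2 ^ (1 * 1) := card_avoiders_le π 1
        _ ≤ 16 ^ 1 := by norm_num
        _ ≤ _ := Nat.pow_le_pow_right (by norm_num) (by omega)
    | succ j ih =>
      have hmaps : ∀ A ∈ avoiders π (2 ^ (j + 1)), contract 2 A ∈ avoiders π (2 ^ j) := by
        intro A hA
        rw [mem_avoiders, pow_succ'] at hA
        exact mem_avoiders.2 ⟨contract_subset hA.1, fun h => hA.2 h.of_contract⟩
      calc (avoiders π (2 ^ (j + 1))).card
          ≤ 16 ^ (C * 2 ^ j) * (avoiders π (2 ^ j)).card := by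
            refine Finset.card_le_mul_card_image_of_maps_to hmaps _ fun B hB => ?_
            rw [mem_avoiders] at hB
            exact (card_filter_contract_two_eq_le _ B).trans
              (Nat.pow_le_pow_right (by norm_num) (hC _ B hB.1 hB.2))
        _ ≤ 16 ^ (C * 2 ^ j) * 16 ^ ((C + 1) * 2 ^ j) := Nat.mul_le_mul_left _ ih
        _ = 16 ^ (C * 2 ^ j + (C + 1) * 2 ^ j) := (pow_add _ _ _).symm
        _ ≤ _ := by
            refine Nat.pow_le_pow_right (by norm_num) ?_
            rw [pow_succ]
            nlinarith [Nat.zero_le (2 ^ j)]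
  refine ⟨16 ^ ((C + 1) * 2), by positivity, fun n => ?_⟩
  rcases Nat.eq_zero_or_pos n with rfl | hn
  · exact (card_avoiders_le π 0).trans (by simp)
  · obtain ⟨j, hj1, hj2⟩ := exists_nat_pow_near (x := n) hn one_lt_two
    have hsub : Finset.range n ⊆ Finset.range (2 ^ (j + 1)) := Finset.range_mono hj2.le
    calc (avoiders π n).card ≤ (avoiders π (2 ^ (j + 1))).card := by
          refine Finset.card_le_card fun A hA => ?_
          rw [mem_avoiders] at hA ⊢
          exact ⟨hA.1.trans (Finset.product_subset_product hsub hsub), hA.2⟩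
      _ ≤ 16 ^ ((C + 1) * 2 ^ (j + 1)) := hpow _
      _ ≤ 16 ^ ((C + 1) * 2 * n) := by
          refine Nat.pow_le_pow_right (by norm_num) ?_
          rw [pow_succ', ← mul_assoc]
          exact Nat.mul_le_mul_left _ hj1
      _ = _ := pow_mul _ _ _

end MarcusTardos

/-! ### Avoiding few bad pairs -/

/-- For a uniformly random `l`, the pair `(l i, l j)` is uniform. The injection records this pair
and overwrites the two coordinates with arbitrary values, which is reversible. -/
theorem card_filter_pair_mem_mul_le {ι κ : Type*} [Fintype ι] [DecidableEq ι] [Fintype κ]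
    [DecidableEq κ] {i j : ι} (hij : i ≠ j) (B : Finset (κ × κ)) :
    (Finset.univ.filter fun l : ι → κ => (l i, l j) ∈ B).card *
      (Fintype.card κ * Fintype.card κ) ≤ B.card * Fintype.card (ι → κ) := by
  have h : ((Finset.univ.filter fun l : ι → κ => (l i, l j) ∈ B) ×ˢ
      (Finset.univ : Finset (κ × κ))).card ≤
      (B ×ˢ (Finset.univ : Finset (ι → κ))).card := by
    refine Finset.card_le_card_of_injOn
      (fun q => ((q.1 i, q.1 j), Function.update (Function.update q.1 i q.2.1) j q.2.2))
      (fun q hq => ?_) ?_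
    · simp only [Finset.coe_product, Set.mem_prod, Finset.mem_coe, Finset.mem_filter] at hq ⊢
      exact ⟨hq.1.2, Finset.mem_univ _⟩
    · rintro ⟨l, x, y⟩ - ⟨l', x', y'⟩ - h
      simp only [Prod.mk.injEq] at h
      obtain ⟨⟨hi, hj⟩, hu⟩ := h
      have hx := congrFun hu i
      have hy := congrFun hu j
      simp only [Function.update_self, Function.update_of_ne hij] at hx hy
      refine Prod.ext (funext fun m => ?_) (Prod.ext hx hy)
      by_cases hmj : m = j
      · rw [hmj]; exact hj
      by_cases hmi : m = i
      · rw [hmi]; exact hi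
      simpa [hmj, hmi] using congrFun hu m
  simpa [Finset.card_product] using h

/-- Union bound over the ordered pairs i ≠ j, with probability at most M / |κ|² each. -/
theorem exists_forall_pair_notMem {ι κ : Type*} [Fintype ι] [Fintype κ]
    (B : ι → ι → Finset (κ × κ)) (M : ℕ) (hB : ∀ i j, i ≠ j → (B i j).card ≤ M)
    (hM : Fintype.card ι * Fintype.card ι * M < Fintype.card κ * Fintype.card κ) :
    ∃ l : ι → κ, ∀ i j, i ≠ j → (l i, l j) ∉ B i j := by
  classical
  by_contra! hbad
  have hcover : (Finset.univ : Finset (ι → κ)) ⊆ (Finset.univ : Finset ι).offDiag.biUnion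
      fun p => Finset.univ.filter fun l : ι → κ => (l p.1, l p.2) ∈ B p.1 p.2 := by
    intro l _
    obtain ⟨i, j, hij, h⟩ := hbad l
    exact Finset.mem_biUnion.2 ⟨(i, j), by simpa using hij, by simpa using h⟩
  have hκ : 0 < Fintype.card κ := Nat.pos_of_ne_zero fun h => by simp [h] at hM
  have : Nonempty κ := Fintype.card_pos_iff.1 hκ
  have hpos : 0 < Fintype.card (ι → κ) := Fintype.card_pos
  have h1 : Fintype.card (ι → κ) * (Fintype.card κ * Fintype.card κ) ≤
      Fintype.card ι * Fintype.card ι * M * Fintype.card (ι → κ) := by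
    calc _ ≤ (∑ p ∈ (Finset.univ : Finset ι).offDiag,
            (Finset.univ.filter fun l : ι → κ => (l p.1, l p.2) ∈ B p.1 p.2).card) *
              (Fintype.card κ * Fintype.card κ) :=
          Nat.mul_le_mul_right _ ((Finset.card_le_card hcover).trans Finset.card_biUnion_le)
      _ ≤ ∑ p ∈ (Finset.univ : Finset ι).offDiag, M * Fintype.card (ι → κ) := by
          rw [Finset.sum_mul]
          refine Finset.sum_le_sum fun p hp => ?_
          have hp' : p.1 ≠ p.2 := by simpa using hp
          exact (card_filter_pair_mem_mul_le hp' _).trans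
            (Nat.mul_le_mul_right _ (hB _ _ hp'))
      _ = (Finset.univ : Finset ι).offDiag.card * (M * Fintype.card (ι → κ)) := by
          rw [Finset.sum_const, smul_eq_mul]
      _ ≤ Fintype.card ι * Fintype.card ι * (M * Fintype.card (ι → κ)) := by
          refine Nat.mul_le_mul_right _ ?_
          rw [Finset.offDiag_card, Finset.card_univ]
          exact Nat.sub_le _ _
      _ = _ := by ring
  have h2 := Nat.mul_lt_mul_of_pos_right hM hpos
  rw [mul_comm] at h1
  omega

namespace OrderedGraph

/-! ### Hereditary properties -/

/-- The ordered graph on `Fin n` with the given edges. -/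
abbrev ofFin {n : ℕ} (G : SimpleGraph (Fin n)) : OrderedGraph where
  V := Fin n
  graph := G

theorem IsHereditary.mem_of_orderEmbedding {P : Set OrderedGraph} (hP : IsHereditary P)
    {G H : OrderedGraph} (hG : G ∈ P) (φ : H.V ↪o G.V)
    (hφ : ∀ x y, G.graph.Adj (φ x) (φ y) ↔ H.graph.Adj x y) : H ∈ P := by
  refine hP.1 (G.induce (Set.range φ)) H (isIsomorphic_equivalence.symm ?_) (hP.2 G hG _)
  exact ⟨φ.orderIso, fun x y => hφ x y⟩

theorem exists_ofFin_isIsomorphic (G : OrderedGraph) {n : ℕ} (hn : G.numVertices = n) :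
    ∃ H : SimpleGraph (Fin n), IsIsomorphic (ofFin H) G := by
  have := Fintype.ofFinite G.V
  have e : Fin n ≃o G.V := Fintype.orderIsoFinOfCardEq G.V
    (by rw [← Nat.card_eq_fintype_card]; exact hn)
  exact ⟨G.graph.comap e, e, fun _ _ => Iff.rfl⟩

/-- A finite linear order has no nontrivial automorphism, so isomorphism classes can be counted as
graphs on `Fin n`. -/
theorem eq_of_isIsomorphic_ofFin {n : ℕ} {G H : SimpleGraph (Fin n)}
    (h : IsIsomorphic (ofFin G) (ofFin H)) : G = H := by
  obtain ⟨φ, hφ⟩ := h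
  obtain rfl : φ = OrderIso.refl (Fin n) := Subsingleton.elim (α := Fin n ≃o Fin n) _ _
  ext x y
  exact (hφ x y).symm

theorem speed_eq_ncard {P : Set OrderedGraph} (hP : IsProperty P) (n : ℕ) :
    speed P n = {G : SimpleGraph (Fin n) | ofFin G ∈ P}.ncard := by
  rw [← Set.ncard_image_of_injective {G : SimpleGraph (Fin n) | ofFin G ∈ P}
    (f := fun G => Quotient.mk isoSetoid (ofFin G))
    fun G H h => eq_of_isIsomorphic_ofFin (Quotient.exact h)]
  unfold speed
  congr 1
  ext q
  constructor
  · rintro ⟨G, ⟨hG, hn⟩, rfl⟩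
    obtain ⟨H, hH⟩ := exists_ofFin_isIsomorphic G hn
    exact ⟨H, hP _ _ (isIsomorphic_equivalence.symm hH) hG, Quotient.sound hH⟩
  · rintro ⟨G, hG, rfl⟩
    exact ⟨ofFin G, ⟨hG, by simp [numVertices]⟩, rfl⟩

/-- In a member of a hereditary property, the number of edges between two disjoint sets of `L`
vertices is bounded by the maximal number of edges of members with `2 L` vertices. -/
theorem ncard_adj_pairs_le {P : Set OrderedGraph} (hP : IsHereditary P) {f : ℕ → ℕ}
    (hf : ∀ n : ℕ, ∀ G ∈ P, G.numVertices = n → G.numEdges ≤ f n)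
    {G : OrderedGraph} (hG : G ∈ P) {L : ℕ} {u v : Fin L → G.V}
    (hu : Function.Injective u) (hv : Function.Injective v) (huv : ∀ x y, u x ≠ v y) :
    {p : Fin L × Fin L | G.graph.Adj (u p.1) (v p.2)}.ncard ≤ f (2 * L) := by
  set w : Fin L ⊕ Fin L → G.V := Sum.elim u v with hw
  have hwi : Function.Injective w := hu.sumElim hv huv
  refine le_trans ?_ (hf (2 * L) _ (hP.2 G hG (Set.range w)) ?_)
  · refine Set.ncard_le_ncard_of_injOn
      (fun p => s(⟨w (.inl p.1), Set.mem_range_self _⟩, ⟨w (.inr p.2), Set.mem_range_self _⟩))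
      (fun p hp => hp) ?_ ?_
    · intro p _ q _ h
      rcases Sym2.eq_iff.1 h with ⟨h1, h2⟩ | ⟨h1, -⟩
      · exact Prod.ext (Sum.inl_injective (hwi (congrArg Subtype.val h1)))
          (Sum.inr_injective (hwi (congrArg Subtype.val h2)))
      · exact absurd (hwi (congrArg Subtype.val h1)) Sum.inl_ne_inr
    · have : Finite (G.induce (Set.range w)).V := (G.induce (Set.range w)).finite
      exact Set.toFinite _
  · change Nat.card (Set.range w) = 2 * L
    rw [Nat.card_range_of_injective hwi]
    simp [two_mul]

/-! ### Matching graphs of permutations -/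

/-- The ordered graph with `2 k` vertices whose edges match the first `k` vertices with the last
`k` vertices according to `σ`. -/
def matchingGraph {k : ℕ} (σ : Equiv.Perm (Fin k)) : OrderedGraph where
  V := Lex (Fin k ⊕ Fin k)
  graph :=
    { Adj := fun x y => (∃ i, x = Sum.inlₗ i ∧ y = Sum.inrₗ (σ i)) ∨
        ∃ i, y = Sum.inlₗ i ∧ x = Sum.inrₗ (σ i)
      symm := ⟨fun _ _ h => h.symm⟩
      loopless := ⟨by
        rintro x (⟨i, rfl, h⟩ | ⟨i, rfl, h⟩) <;>
        exact Sum.inl_ne_inr (toLex.injective h)⟩ }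

theorem matchingGraph_adj_inl_inl {k : ℕ} (σ : Equiv.Perm (Fin k)) (i j : Fin k) :
    ¬ (matchingGraph σ).graph.Adj (Sum.inlₗ i) (Sum.inlₗ j) := by
  rintro (⟨m, h, h'⟩ | ⟨m, h, h'⟩) <;> exact Sum.inl_ne_inr (toLex.injective h')

theorem matchingGraph_adj_inr_inr {k : ℕ} (σ : Equiv.Perm (Fin k)) (i j : Fin k) :
    ¬ (matchingGraph σ).graph.Adj (Sum.inrₗ i) (Sum.inrₗ j) := by
  rintro (⟨m, h, h'⟩ | ⟨m, h, h'⟩) <;> exact Sum.inr_ne_inl (toLex.injective h)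

theorem matchingGraph_adj_inl_inr {k : ℕ} (σ : Equiv.Perm (Fin k)) (i j : Fin k) :
    (matchingGraph σ).graph.Adj (Sum.inlₗ i) (Sum.inrₗ j) ↔ σ i = j := by
  constructor
  · rintro (⟨m, h, h'⟩ | ⟨m, h, h'⟩)
    · rw [Sum.inl_injective (toLex.injective h), Sum.inr_injective (toLex.injective h')]
    · exact absurd (toLex.injective h') Sum.inl_ne_inr
  · rintro rfl
    exact Or.inl ⟨i, rfl, rfl⟩

/-- If a sparse hereditary property contains a graph in which a sufficiently large blow-up of
the matching of `σ` occurs as a subgraph, then it contains the matching graph of `σ`. -/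
theorem matchingGraph_mem_of_blowup {P : Set OrderedGraph} (hP : IsHereditary P) {f : ℕ → ℕ}
    (hf : ∀ n : ℕ, ∀ G ∈ P, G.numVertices = n → G.numEdges ≤ f n)
    {G : OrderedGraph} (hG : G ∈ P) {k L : ℕ} (σ : Equiv.Perm (Fin k))
    (hL : k * k * (3 * f (2 * L)) < L * L) {r c : Lex (Fin k × Fin L) → G.V}
    (hr : StrictMono r) (hc : StrictMono c) (hrc : ∀ x y, r x < c y)
    (hadj : ∀ i x, G.graph.Adj (r (toLex (i, x))) (c (toLex (σ i, x)))) :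
    matchingGraph σ ∈ P := by
  classical
  have hinj : ∀ {w : Lex (Fin k × Fin L) → G.V}, StrictMono w → ∀ i,
      Function.Injective fun x => w (toLex (i, x)) := fun hw i x y h => by
    simpa using hw.injective h
  have hdisj : ∀ {w : Lex (Fin k × Fin L) → G.V}, StrictMono w → ∀ {i j}, i ≠ j → ∀ x y,
      w (toLex (i, x)) ≠ w (toLex (j, y)) := fun hw i j hij x y h => by
    have := hw.injective h
    simp only [EmbeddingLike.apply_eq_iff_eq, Prod.mk.injEq] at this
    exact hij this.1
  set E : (Fin L → G.V) → (Fin L → G.V) → Finset (Fin L × Fin L) :=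
    fun u v => Finset.univ.filter fun p => G.graph.Adj (u p.1) (v p.2) with hE
  have hEc : ∀ {u v : Fin L → G.V}, Function.Injective u → Function.Injective v →
      (∀ x y, u x ≠ v y) → (E u v).card ≤ f (2 * L) := by
    intro u v hu hv huv
    have := ncard_adj_pairs_le hP hf hG hu hv huv
    rwa [Set.ncard_eq_toFinset_card', Set.toFinset_ofPred] at this
  -- Row cluster i and column cluster σ i share the label `l i`, so the wanted edge survives by
  -- `hadj`. The bad pairs are the row–row, column–column and row–column edges between different
  -- indices: three sets of at most f(2L) pairs.
  obtain ⟨l, hl⟩ := exists_forall_pair_notMem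
    (fun i j : Fin k =>
      E (fun x => r (toLex (i, x))) (fun x => r (toLex (j, x))) ∪
      (E (fun x => c (toLex (σ i, x))) (fun x => c (toLex (σ j, x))) ∪
      E (fun x => r (toLex (i, x))) (fun x => c (toLex (σ j, x))))) (3 * f (2 * L))
    (fun i j hij => by
      refine (Finset.card_union_le _ _).trans ?_
      have h1 := Finset.card_union_le
        (E (fun x => c (toLex (σ i, x))) (fun x => c (toLex (σ j, x))))
        (E (fun x => r (toLex (i, x))) (fun x => c (toLex (σ j, x))))
      have h2 := hEc (hinj hr i) (hinj hr j) (hdisj hr hij)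
      have h3 := hEc (hinj hc (σ i)) (hinj hc (σ j)) (hdisj hc (σ.injective.ne hij))
      have h4 := hEc (hinj hr i) (hinj hc (σ j)) (fun x y => (hrc _ _).ne)
      omega)
    (by simpa using hL)
  simp only [hE, Finset.mem_union, Finset.mem_filter, Finset.mem_univ, true_and,
    not_or] at hl
  set φ : (matchingGraph σ).V → G.V := fun z =>
    Sum.elim (fun i => r (toLex (i, l i))) (fun j => c (toLex (j, l (σ.symm j)))) (ofLex z)
    with hφ
  have hmono : StrictMono φ := by
    intro a b hab
    change Lex (Fin k ⊕ Fin k) at a b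
    induction a using Lex.rec with | _ a
    induction b using Lex.rec with | _ b
    rcases a with i | i <;> rcases b with j | j
    · exact hr (Prod.Lex.toLex_lt_toLex.2 (Or.inl (Sum.Lex.inl_lt_inl_iff.1 hab)))
    · exact hrc _ _
    · exact absurd hab Sum.Lex.not_inr_lt_inl
    · exact hc (Prod.Lex.toLex_lt_toLex.2 (Or.inl (Sum.Lex.inr_lt_inr_iff.1 hab)))
  have hcross : ∀ i j, G.graph.Adj (r (toLex (i, l i))) (c (toLex (j, l (σ.symm j)))) ↔
      σ i = j := by
    intro i j
    obtain ⟨j, rfl⟩ := σ.surjective j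
    rw [σ.symm_apply_apply, σ.injective.eq_iff]
    constructor
    · intro h
      by_contra hij
      exact (hl i j hij).2.2 h
    · rintro rfl
      exact hadj i _
  refine hP.mem_of_orderEmbedding hG (OrderEmbedding.ofStrictMono φ hmono) fun a b => ?_
  change G.graph.Adj (φ a) (φ b) ↔ _
  change Lex (Fin k ⊕ Fin k) at a b
  induction a using Lex.rec with | _ a
  induction b using Lex.rec with | _ b
  rcases a with i | i <;> rcases b with j | j
  · refine iff_of_false (fun h => ?_) (matchingGraph_adj_inl_inl σ i j)
    by_cases hij : i = j
    · subst hij; exact G.graph.loopless.irrefl _ h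
    · exact (hl i j hij).1 h
  · exact (hcross i j).trans (matchingGraph_adj_inl_inr σ i j).symm
  · exact (G.graph.adj_comm _ _).trans ((hcross j i).trans
      ((matchingGraph_adj_inl_inr σ j i).symm.trans ((matchingGraph σ).graph.adj_comm _ _)))
  · refine iff_of_false (fun h => ?_) (matchingGraph_adj_inr_inr σ i j)
    obtain ⟨i, rfl⟩ := σ.surjective i
    obtain ⟨j, rfl⟩ := σ.surjective j
    by_cases hij : i = j
    · subst hij; exact G.graph.loopless.irrefl _ h
    · refine (hl i j hij).2.1 ?_
      simpa [hφ] using h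

/-! ### Ordered graphs as sets of cells -/

/-- The upper triangular part of the adjacency matrix of `G`, as a set of cells. -/
noncomputable def cells {n : ℕ} (G : SimpleGraph (Fin n)) : Finset (ℕ × ℕ) :=
  open scoped Classical in
  (Finset.univ.filter fun p : Fin n × Fin n => p.1 < p.2 ∧ G.Adj p.1 p.2).image
    fun p => ((p.1 : ℕ), (p.2 : ℕ))

theorem mem_cells {n : ℕ} {G : SimpleGraph (Fin n)} {p : ℕ × ℕ} :
    p ∈ cells G ↔ ∃ i j : Fin n, i < j ∧ G.Adj i j ∧ (i : ℕ) = p.1 ∧ (j : ℕ) = p.2 := by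
  simp [cells, Prod.ext_iff, and_assoc]

theorem cells_subset {n : ℕ} (G : SimpleGraph (Fin n)) :
    cells G ⊆ Finset.range n ×ˢ Finset.range n := by
  intro p hp
  obtain ⟨i, j, -, -, hi, hj⟩ := mem_cells.1 hp
  rw [Finset.mem_product, Finset.mem_range, Finset.mem_range, ← hi, ← hj]
  exact ⟨i.2, j.2⟩

theorem adj_iff_mem_cells {n : ℕ} {G : SimpleGraph (Fin n)} {i j : Fin n} (hij : i < j) :
    G.Adj i j ↔ ((i : ℕ), (j : ℕ)) ∈ cells G := by
  rw [mem_cells]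
  constructor
  · exact fun h => ⟨i, j, hij, h, rfl, rfl⟩
  · rintro ⟨i', j', -, h, hi, hj⟩
    rwa [Fin.ext hi, Fin.ext hj] at h

theorem cells_injective (n : ℕ) :
    Function.Injective (cells : SimpleGraph (Fin n) → Finset (ℕ × ℕ)) := by
  intro G H h
  ext i j
  rcases lt_trichotomy i j with hij | rfl | hij
  · rw [adj_iff_mem_cells hij, adj_iff_mem_cells hij, h]
  · simp
  · rw [G.adj_comm, H.adj_comm, adj_iff_mem_cells hij, adj_iff_mem_cells hij, h]

/-- The permutation pattern that forces the blow-up of `σ` by a factor `L`: the additional last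
row and first column ensure that in an upper triangular matrix the remaining rows precede the
remaining columns. -/
def blowupPattern {k : ℕ} (σ : Equiv.Perm (Fin k)) (L : ℕ) :
    Lex (Lex (Fin k × Fin L) ⊕ Unit) ≃ Lex (Unit ⊕ Lex (Fin k × Fin L)) :=
  ofLex.trans (((Equiv.sumComm _ _).trans ((Equiv.refl Unit).sumCongr
    (ofLex.trans ((σ.prodCongr (Equiv.refl (Fin L))).trans toLex)))).trans toLex)

theorem matchingGraph_mem_of_containsPattern {P : Set OrderedGraph} (hP : IsHereditary P)
    {f : ℕ → ℕ} (hf : ∀ n : ℕ, ∀ G ∈ P, G.numVertices = n → G.numEdges ≤ f n)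
    {k L : ℕ} (σ : Equiv.Perm (Fin k)) (hL : k * k * (3 * f (2 * L)) < L * L)
    {n : ℕ} {G : SimpleGraph (Fin n)} (hG : ofFin G ∈ P)
    (h : ContainsPattern (blowupPattern σ L) (cells G)) : matchingGraph σ ∈ P := by
  obtain ⟨r, c, hr, hc, h⟩ := h
  -- The auxiliary cell lies in the last row and first column of the pattern; being above the
  -- diagonal, it puts every row before every column.
  have hlt : r (Sum.inrₗ ()) < c (Sum.inlₗ ()) := by
    obtain ⟨i, j, hij, -, hi, hj⟩ := mem_cells.1 (h (Sum.inrₗ ()))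
    exact (hi.symm.trans_lt hij).trans_eq hj
  have h1 : ∀ x, r (Sum.inlₗ x) < r (Sum.inrₗ ()) := fun x => hr (Sum.Lex.inl_lt_inr _ _)
  have h2 : ∀ y, c (Sum.inlₗ ()) < c (Sum.inrₗ y) := fun y => hc (Sum.Lex.inl_lt_inr _ _)
  have hmem : ∀ i x, (r (Sum.inlₗ (toLex (i, x))), c (Sum.inrₗ (toLex (σ i, x)))) ∈ cells G :=
    fun i x => h (Sum.inlₗ (toLex (i, x)))
  have hrn : ∀ x, r (Sum.inlₗ x) < n := fun x =>
    Finset.mem_range.1 (Finset.mem_product.1 (cells_subset G (hmem (ofLex x).1 (ofLex x).2))).1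
  have hcn : ∀ y, c (Sum.inrₗ y) < n := fun y => by
    have := (Finset.mem_product.1 (cells_subset G (hmem (σ.symm (ofLex y).1) (ofLex y).2))).2
    rw [σ.apply_symm_apply] at this
    exact Finset.mem_range.1 this
  refine matchingGraph_mem_of_blowup hP hf hG σ hL
    (r := fun x => (⟨r (Sum.inlₗ x), hrn x⟩ : Fin n))
    (c := fun y => (⟨c (Sum.inrₗ y), hcn y⟩ : Fin n))
    (fun x y hxy => hr (Sum.Lex.inl_lt_inl_iff.2 hxy))
    (fun x y hxy => hc (Sum.Lex.inr_lt_inr_iff.2 hxy))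
    (fun x y => (h1 x).trans (hlt.trans (h2 y))) fun i x => ?_
  exact (adj_iff_mem_cells (Fin.mk_lt_mk.2 ((h1 _).trans (hlt.trans (h2 _))))).2 (hmem i x)

/-! ### Sparsity and superexponential speed yield all matchings. -/

theorem exists_mul_lt_mul_self_of_isLittleO {f : ℕ → ℕ}
    (hf : (fun n : ℕ => (f n : ℝ)) =o[atTop] (fun n : ℕ => (n : ℝ) ^ 2)) (C : ℕ) :
    ∃ L : ℕ, C * (3 * f (2 * L)) < L * L := by
  -- At 2L this gives f(2L) ≤ 4L² / (12(C + 1)), that is 3(C + 1) f(2L) ≤ L².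
  have hC : (0 : ℝ) < 1 / (12 * (C + 1)) := by positivity
  obtain ⟨N, hN⟩ := eventually_atTop.1 (hf.bound hC)
  refine ⟨N + 1, ?_⟩
  have h := hN (2 * (N + 1)) (by omega)
  rw [Real.norm_of_nonneg (by positivity), Real.norm_of_nonneg (by positivity),
    div_mul_eq_mul_div, le_div_iff₀ (by positivity)] at h
  push_cast at h
  have h' : (C : ℝ) * (3 * f (2 * (N + 1))) < ((N : ℝ) + 1) * (N + 1) := by
    have hf0 : (0 : ℝ) ≤ f (2 * (N + 1)) := Nat.cast_nonneg _
    have hN0 : (0 : ℝ) ≤ N := Nat.cast_nonneg _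
    have hC0 : (0 : ℝ) ≤ C := Nat.cast_nonneg _
    rcases hf0.eq_or_lt with h0 | h0
    · rw [← h0, mul_zero, mul_zero]; positivity
    · nlinarith
  exact_mod_cast h'

/-- A sparse hereditary property of superexponential speed contains all matching graphs of
permutations. -/
theorem matchingGraph_mem {P : Set OrderedGraph} (hP : IsHereditary P) {f : ℕ → ℕ}
    (hf : (fun n : ℕ => (f n : ℝ)) =o[atTop] (fun n : ℕ => (n : ℝ) ^ 2))
    (hedges : ∀ n : ℕ, ∀ G ∈ P, G.numVertices = n → G.numEdges ≤ f n)
    (hspeed : ∀ c : ℝ, 0 < c → ∃ N : ℕ, c ^ N < (speed P N : ℝ))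
    {k : ℕ} (σ : Equiv.Perm (Fin k)) : matchingGraph σ ∈ P := by
  by_contra hσ
  obtain ⟨L, hL⟩ := exists_mul_lt_mul_self_of_isLittleO hf (k * k)
  obtain ⟨c, hc0, hc⟩ := exists_card_avoiders_le_pow (blowupPattern σ L)
  obtain ⟨N, hN⟩ := hspeed c (by exact_mod_cast hc0)
  -- Were the matching of σ missing, no member could contain the blow-up pattern, so `cells` would
  -- embed P_N into the avoiders.
  have hle : speed P N ≤ (avoiders (blowupPattern σ L) N).card := by
    rw [speed_eq_ncard hP.1, ← Set.ncard_coe_finset]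
    refine Set.ncard_le_ncard_of_injOn cells (fun G hG => ?_) (cells_injective N).injOn
    exact mem_avoiders.2 ⟨cells_subset G, fun h =>
      hσ (matchingGraph_mem_of_containsPattern hP hedges σ hL hG h)⟩
  have : speed P N ≤ c ^ N := hle.trans (hc N)
  exact absurd hN (not_lt.2 (by exact_mod_cast this))

/-! ### Graphs of involutions -/

/-- The graph that joins each point moved by the involution `π` to its image. -/
def involutionGraph {n : ℕ} (π : Equiv.Perm (Fin n)) (hπ : Function.Involutive π) :
    SimpleGraph (Fin n) where
  Adj v w := v ≠ w ∧ π v = w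
  symm := ⟨fun v w h => ⟨h.1.symm, by rw [← h.2, hπ v]⟩⟩
  loopless := ⟨fun _ h => h.1 rfl⟩

theorem eq_of_involutionGraph_eq {n : ℕ} {π ρ : Equiv.Perm (Fin n)}
    {hπ : Function.Involutive π} {hρ : Function.Involutive ρ}
    (h : involutionGraph π hπ = involutionGraph ρ hρ) : π = ρ := by
  have hadj : ∀ v w, (v ≠ w ∧ π v = w) ↔ (v ≠ w ∧ ρ v = w) := fun v w => by
    change (involutionGraph π hπ).Adj v w ↔ (involutionGraph ρ hρ).Adj v w
    rw [h]
  ext1 v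
  by_cases hv : v = π v
  · by_contra hne
    have := (hadj v (ρ v)).2 ⟨fun h => hne (hv.symm.trans h), rfl⟩
    exact hne this.2
  · exact ((hadj v (π v)).1 ⟨hv, rfl⟩).2.symm

/-- The host is `matchingGraph π` on two copies of `Fin n`: points of `D` go to the first copy, the
others to the second, and order survives because `D` is an initial segment. A fixed point of π
becomes isolated, its partner being left out. -/
theorem involutionGraph_mem {P : Set OrderedGraph} (hP : IsHereditary P)
    (hmatch : ∀ (k : ℕ) (σ : Equiv.Perm (Fin k)), matchingGraph σ ∈ P)
    {n : ℕ} (π : Equiv.Perm (Fin n)) (hπ : Function.Involutive π) {D : Set (Fin n)}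
    (hD : IsLowerSet D) (hDπ : ∀ v, v ≠ π v → (v ∈ D ↔ π v ∉ D)) :
    ofFin (involutionGraph π hπ) ∈ P := by
  classical
  set φ : Fin n → Lex (Fin n ⊕ Fin n) := fun v => if v ∈ D then Sum.inlₗ v else Sum.inrₗ v
    with hφ
  have hl : ∀ {v}, v ∈ D → φ v = Sum.inlₗ v := fun h => if_pos h
  have hr : ∀ {v}, v ∉ D → φ v = Sum.inrₗ v := fun h => if_neg h
  have hmono : StrictMono φ := by
    intro v w hvw
    by_cases hv : v ∈ D <;> by_cases hw : w ∈ D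
    · rw [hl hv, hl hw]; exact Sum.Lex.inl_lt_inl_iff.2 hvw
    · rw [hl hv, hr hw]; exact Sum.Lex.inl_lt_inr _ _
    · exact absurd (hD hvw.le hw) hv
    · rw [hr hv, hr hw]; exact Sum.Lex.inr_lt_inr_iff.2 hvw
  have hcross : ∀ {v w}, v ∈ D → w ∉ D →
      ((matchingGraph π).graph.Adj (φ v) (φ w) ↔ (involutionGraph π hπ).Adj v w) := by
    intro v w hv hw
    rw [hl hv, hr hw]
    refine (matchingGraph_adj_inl_inr π v w).trans ⟨fun h => ⟨?_, h⟩, fun h => h.2⟩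
    rintro rfl
    exact hw hv
  refine hP.mem_of_orderEmbedding (hmatch n π) (H := ofFin (involutionGraph π hπ))
    (OrderEmbedding.ofStrictMono φ hmono) fun v w => ?_
  change (matchingGraph π).graph.Adj (φ v) (φ w) ↔ (involutionGraph π hπ).Adj v w
  by_cases hv : v ∈ D <;> by_cases hw : w ∈ D
  · refine iff_of_false ?_ ?_
    · rw [hl hv, hl hw]; exact matchingGraph_adj_inl_inl π v w
    · rintro ⟨hvw, rfl⟩
      exact (hDπ v hvw).1 hv hw
  · exact hcross hv hw
  · exact (SimpleGraph.adj_comm _ _ _).trans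
      ((hcross hw hv).trans (SimpleGraph.adj_comm _ _ _))
  · refine iff_of_false ?_ ?_
    · rw [hr hv, hr hw]; exact matchingGraph_adj_inr_inr π v w
    · rintro ⟨hvw, rfl⟩
      exact hv ((hDπ v hvw).2 hw)

/-! ### Matchings between the halves of a set of vertices -/

/-- The involution of `Fin k ⊕ Fin k` that exchanges `inl i` and `inr (σ i)`. -/
def swapPerm {k : ℕ} (σ : Equiv.Perm (Fin k)) : Equiv.Perm (Fin k ⊕ Fin k) :=
  (σ.sumCongr σ.symm).trans (Equiv.sumComm _ _)

theorem swapPerm_involutive {k : ℕ} (σ : Equiv.Perm (Fin k)) :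
    Function.Involutive (swapPerm σ) := by
  rintro (i | i) <;> simp [swapPerm]

theorem swapPerm_ne {k : ℕ} (σ : Equiv.Perm (Fin k)) (x : Fin k ⊕ Fin k) :
    swapPerm σ x ≠ x := by
  rcases x with i | i <;> simp [swapPerm]

theorem swapPerm_injective (k : ℕ) :
    Function.Injective (swapPerm : Equiv.Perm (Fin k) → Equiv.Perm (Fin k ⊕ Fin k)) := by
  intro σ τ h
  ext1 i
  have := congrArg (fun ρ : Equiv.Perm (Fin k ⊕ Fin k) => ρ (.inl i)) h
  simpa [swapPerm] using this

variable {n k : ℕ}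

/-- The increasing enumeration of a set of `2 k` vertices. -/
noncomputable def enumerate (S : Finset (Fin n)) (hS : S.card = 2 * k) :
    Lex (Fin k ⊕ Fin k) ≃o {v // v ∈ S} :=
  (Fintype.orderIsoFinOfCardEq (Lex (Fin k ⊕ Fin k))
    (by simp [two_mul] : Fintype.card (Lex (Fin k ⊕ Fin k)) = 2 * k)).symm.trans
    (S.orderIsoOfFin hS)

/-- The involution that matches the first `k` elements of `S` with the last `k` elements
according to `σ` and fixes everything else. -/
noncomputable def matchingPerm (S : Finset (Fin n)) (hS : S.card = 2 * k)
    (σ : Equiv.Perm (Fin k)) : Equiv.Perm (Fin n) :=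
  (swapPerm σ).extendDomain (toLex.trans (enumerate S hS).toEquiv)

theorem matchingPerm_enumerate (S : Finset (Fin n)) (hS : S.card = 2 * k)
    (σ : Equiv.Perm (Fin k)) (x : Fin k ⊕ Fin k) :
    matchingPerm S hS σ (enumerate S hS (toLex x)) = enumerate S hS (toLex (swapPerm σ x)) :=
  Equiv.Perm.extendDomain_apply_image _ (toLex.trans (enumerate S hS).toEquiv) x

theorem matchingPerm_of_notMem {S : Finset (Fin n)} (hS : S.card = 2 * k)
    (σ : Equiv.Perm (Fin k)) {v : Fin n} (hv : v ∉ S) : matchingPerm S hS σ v = v :=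
  Equiv.Perm.extendDomain_apply_not_subtype _ _ hv

theorem exists_enumerate_eq {S : Finset (Fin n)} (hS : S.card = 2 * k) {v : Fin n}
    (hv : v ∈ S) : ∃ x, (enumerate S hS (toLex x) : Fin n) = v := by
  obtain ⟨x, hx⟩ := (enumerate S hS).surjective ⟨v, hv⟩
  exact ⟨ofLex x, by rw [toLex_ofLex, hx]⟩

theorem matchingPerm_involutive (S : Finset (Fin n)) (hS : S.card = 2 * k)
    (σ : Equiv.Perm (Fin k)) : Function.Involutive (matchingPerm S hS σ) := by
  intro v
  by_cases hv : v ∈ S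
  · obtain ⟨x, rfl⟩ := exists_enumerate_eq hS hv
    rw [matchingPerm_enumerate, matchingPerm_enumerate, swapPerm_involutive]
  · rw [matchingPerm_of_notMem hS σ hv, matchingPerm_of_notMem hS σ hv]

/-- Recovers `S`, hence k, from the graph when distinct choices are separated. -/
theorem matchingPerm_ne_iff (S : Finset (Fin n)) (hS : S.card = 2 * k)
    (σ : Equiv.Perm (Fin k)) (v : Fin n) : matchingPerm S hS σ v ≠ v ↔ v ∈ S := by
  refine ⟨fun h => by_contra fun hv => h (matchingPerm_of_notMem hS σ hv), fun hv h => ?_⟩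
  obtain ⟨x, rfl⟩ := exists_enumerate_eq hS hv
  rw [matchingPerm_enumerate] at h
  exact swapPerm_ne σ x (toLex.injective ((enumerate S hS).injective (Subtype.ext h)))

theorem matchingPerm_injective (S : Finset (Fin n)) (hS : S.card = 2 * k) :
    Function.Injective (matchingPerm S hS) :=
  fun _ _ h => swapPerm_injective k (Equiv.Perm.extendDomainHom_injective
    (toLex.trans (enumerate S hS).toEquiv) h)

/-- The graph of `matchingPerm`. -/
noncomputable def partialMatching (S : Finset (Fin n)) (hS : S.card = 2 * k)
    (σ : Equiv.Perm (Fin k)) : SimpleGraph (Fin n) :=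
  involutionGraph (matchingPerm S hS σ) (matchingPerm_involutive S hS σ)

theorem partialMatching_mem {P : Set OrderedGraph} (hP : IsHereditary P)
    (hmatch : ∀ (k : ℕ) (σ : Equiv.Perm (Fin k)), matchingGraph σ ∈ P)
    (S : Finset (Fin n)) (hS : S.card = 2 * k) (σ : Equiv.Perm (Fin k)) :
    ofFin (partialMatching S hS σ) ∈ P := by
  set e : Fin k ⊕ Fin k → Fin n := fun x => enumerate S hS (toLex x) with he
  have hlt : ∀ i j, e (.inl i) < e (.inr j) := fun i j =>
    (enumerate S hS).strictMono (Sum.Lex.inl_lt_inr i j)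
  -- The initial segment ending at the last vertex of the lower half; it is empty when k = 0.
  set D : Set (Fin n) := {v | ∃ i, v ≤ e (.inl i)} with hD
  have hl : ∀ i, e (.inl i) ∈ D := fun i => ⟨i, le_rfl⟩
  have hr : ∀ i, e (.inr i) ∉ D := fun i ⟨j, hj⟩ => absurd (hlt j i) (not_lt.2 hj)
  refine involutionGraph_mem hP hmatch _ _ (D := D)
    (fun v w hwv ⟨i, hi⟩ => ⟨i, hwv.trans hi⟩) fun v hv => ?_
  obtain ⟨x, rfl⟩ := exists_enumerate_eq hS ((matchingPerm_ne_iff S hS σ v).1 hv.symm)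
  rw [matchingPerm_enumerate]
  rcases x with i | i
  · exact iff_of_true (hl i) (hr (σ i))
  · exact iff_of_false (hr i) (not_not.2 (hl (σ.symm i)))

theorem card_powersetCard_sigma (n : ℕ) :
    Fintype.card (Σ k : Fin (n / 2 + 1),
      {S : Finset (Fin n) // S.card = 2 * (k : ℕ)} × Equiv.Perm (Fin k)) = factorialSpeed n := by
  rw [Fintype.card_sigma, factorialSpeed, Finset.sum_range]
  refine Finset.sum_congr rfl fun k _ => ?_
  rw [Fintype.card_prod, Fintype.card_perm, Fintype.card_fin, Fintype.card_finset_len,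
    Fintype.card_fin]

theorem factorialSpeed_le_speed {P : Set OrderedGraph} (hP : IsHereditary P)
    (hmatch : ∀ (k : ℕ) (σ : Equiv.Perm (Fin k)), matchingGraph σ ∈ P) (n : ℕ) :
    factorialSpeed n ≤ speed P n := by
  rw [speed_eq_ncard hP.1, ← card_powersetCard_sigma, ← Nat.card_eq_fintype_card,
    ← Set.ncard_univ]
  refine Set.ncard_le_ncard_of_injOn (fun q => partialMatching q.2.1.1 q.2.1.2 q.2.2)
    (fun q _ => partialMatching_mem hP hmatch _ _ _) ?_ (Set.toFinite _)
  rintro ⟨k, ⟨S, hS⟩, σ⟩ - ⟨k', ⟨S', hS'⟩, σ'⟩ - h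
  have hperm : matchingPerm S hS σ = matchingPerm S' hS' σ' := eq_of_involutionGraph_eq h
  obtain rfl : S = S' := by
    ext v
    rw [← matchingPerm_ne_iff S hS σ, hperm, matchingPerm_ne_iff]
  obtain rfl : k = k' := Fin.ext (by omega)
  rw [matchingPerm_injective S hS hperm]

/-! ### Asymptotics of the factorial speed -/

theorem factorialSpeed_le (n : ℕ) : factorialSpeed n ≤ 2 ^ n * (n / 2).factorial := by
  calc factorialSpeed n
      ≤ ∑ k ∈ Finset.range (n / 2 + 1), n.choose (2 * k) * (n / 2).factorial :=
        Finset.sum_le_sum fun k hk => Nat.mul_le_mul_left _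
          (Nat.factorial_le (Nat.lt_succ_iff.1 (Finset.mem_range.1 hk)))
    _ = (∑ k ∈ Finset.range (n / 2 + 1), n.choose (2 * k)) * (n / 2).factorial :=
        (Finset.sum_mul _ _ _).symm
    _ ≤ _ := by
        refine Nat.mul_le_mul_right _ ?_
        rw [← Nat.sum_range_choose,
          ← Finset.sum_image (f := fun m => n.choose m) (g := fun k => 2 * k)
            (fun a _ b _ h => by simpa using h)]
        refine Finset.sum_le_sum_of_subset fun m hm => ?_
        obtain ⟨k, hk, rfl⟩ := Finset.mem_image.1 hm
        rw [Finset.mem_range] at hk ⊢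
        omega

theorem factorial_half_le_factorialSpeed (n : ℕ) : (n / 2).factorial ≤ factorialSpeed n := by
  calc (n / 2).factorial ≤ n.choose (2 * (n / 2)) * (n / 2).factorial :=
        Nat.le_mul_of_pos_left _ (Nat.choose_pos (Nat.mul_div_le n 2))
    _ ≤ _ := Finset.single_le_sum (f := fun k => n.choose (2 * k) * k.factorial)
        (fun _ _ => Nat.zero_le _) (Finset.self_mem_range_succ _)

theorem log_factorialSpeed_le {n : ℕ} (hn : 2 ≤ n) :
    Real.log (factorialSpeed n) ≤ n / 2 * Real.log n + n := by
  have hpos : (0 : ℝ) < factorialSpeed n := by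
    exact_mod_cast (Nat.factorial_pos _).trans_le (factorial_half_le_factorialSpeed n)
  have hn0 : (0 : ℝ) < n := by positivity
  have h1 : (factorialSpeed n : ℝ) ≤ 2 ^ n * (n : ℝ) ^ (n / 2) := by
    have h2 : (n / 2).factorial ≤ n ^ (n / 2) :=
      (Nat.factorial_le_pow _).trans (Nat.pow_le_pow_left (Nat.div_le_self n 2) _)
    exact_mod_cast (factorialSpeed_le n).trans (Nat.mul_le_mul_left _ h2)
  have h3 : Real.log (factorialSpeed n) ≤ n * Real.log 2 + (n / 2 : ℕ) * Real.log n := by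
    have := Real.log_le_log hpos h1
    rwa [Real.log_mul (by positivity) (by positivity), Real.log_pow, Real.log_pow] at this
  have h4 : ((n / 2 : ℕ) : ℝ) ≤ n / 2 := by exact_mod_cast Nat.cast_div_le
  have h5 : 0 ≤ Real.log n := Real.log_nonneg (by exact_mod_cast (by omega : 1 ≤ n))
  have h6 := Real.log_two_lt_d9
  nlinarith

/-- Uses k! ≥ (k/e)^k for k = ⌊n/2⌋. Replacing log k by log n costs at most 2k, and replacing k by
n/2 costs at most (log n)/2. -/
theorem le_log_factorialSpeed {n : ℕ} (hn : 2 ≤ n) :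
    n / 2 * Real.log n - 3 * n ≤ Real.log (factorialSpeed n) := by
  set k := n / 2 with hk
  have hk1 : 1 ≤ k := by omega
  have hkn : (n : ℝ) ≤ 2 * k + 1 := by exact_mod_cast (by omega : n ≤ 2 * k + 1)
  have hkn' : 2 * (k : ℝ) ≤ n := by exact_mod_cast (by omega : 2 * k ≤ n)
  have hk0 : (1 : ℝ) ≤ k := by exact_mod_cast hk1
  have hn0 : (0 : ℝ) < n := by positivity
  have h1 : (k : ℝ) * Real.log k - k ≤ Real.log (factorialSpeed n) := by
    have h2 : ((k : ℝ) / Real.exp 1) ^ k ≤ k.factorial := by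
      have := Real.pow_div_factorial_le_exp (k : ℝ) (by linarith) k
      rw [div_le_iff₀ (by positivity)] at this
      rw [div_pow, Real.exp_one_pow, div_le_iff₀ (Real.exp_pos _)]
      linarith
    have h3 : ((k : ℝ) / Real.exp 1) ^ k ≤ factorialSpeed n :=
      h2.trans (by exact_mod_cast factorial_half_le_factorialSpeed n)
    have h4 := Real.log_le_log (by positivity) h3
    rw [Real.log_pow, Real.log_div (by positivity) (Real.exp_ne_zero 1), Real.log_exp] at h4
    linarith
  have h5 : Real.log n ≤ Real.log k + 2 := by
    -- Here n ≤ 2k + 1 ≤ 3k and e² ≥ 3.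
    have h6 : (n : ℝ) ≤ k * Real.exp 2 := by
      have := Real.add_one_le_exp 2
      nlinarith
    have h7 := Real.log_le_log hn0 h6
    rwa [Real.log_mul (by positivity) (Real.exp_ne_zero 2), Real.log_exp] at h7
  have h8 : Real.log n ≤ n - 1 := Real.log_le_sub_one_of_pos hn0
  have h9 : 0 ≤ Real.log n := Real.log_nonneg (by linarith)
  have h10 : (k : ℝ) * Real.log n ≤ k * (Real.log k + 2) :=
    mul_le_mul_of_nonneg_left h5 (by linarith)
  have h11 : (n : ℝ) * Real.log n ≤ (2 * k + 1) * Real.log n :=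
    mul_le_mul_of_nonneg_right hkn h9
  linarith

theorem exists_factorialSpeed_eq_rpow :
    ∃ ε : ℕ → ℝ, ε =o[atTop] (fun n : ℕ => (n : ℝ)) ∧
      ∀ n : ℕ, 1 ≤ n → (factorialSpeed n : ℝ) = (n : ℝ) ^ ((n : ℝ) / 2 + ε n) := by
  refine ⟨fun n => Real.log (factorialSpeed n) / Real.log n - n / 2, ?_, fun n hn => ?_⟩
  · have hlog : Tendsto (fun n : ℕ => Real.log n) atTop atTop :=
      Real.tendsto_log_atTop.comp tendsto_natCast_atTop_atTop
    refine isLittleO_iff.2 fun c hc => ?_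
    -- The two logarithmic bounds give |ε n| ≤ 3n / log n, which is at most c n once log n ≥ 3/c.
    filter_upwards [eventually_ge_atTop 2, hlog.eventually_ge_atTop (3 / c),
      hlog.eventually_gt_atTop 0] with n hn hn3 hn0
    have h1 := log_factorialSpeed_le hn
    have h2 := le_log_factorialSpeed hn
    have hnn : (0 : ℝ) ≤ n := Nat.cast_nonneg n
    rw [div_le_iff₀ hc] at hn3
    have h3 : 3 * (n : ℝ) ≤ c * n * Real.log n := by nlinarith
    rw [Real.norm_of_nonneg hnn, Real.norm_eq_abs, abs_le]
    constructor
    · rw [neg_le_sub_iff_le_add, ← sub_le_iff_le_add, le_div_iff₀ hn0]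
      linarith
    · rw [sub_le_iff_le_add, div_le_iff₀ hn0]
      linarith
  -- At n = 1 the quotient by log 1 = 0 is a default value, harmless since both sides equal 1.
  · rcases hn.eq_or_lt with rfl | hn
    · simp [factorialSpeed]
    · have hpos : (0 : ℝ) < factorialSpeed n := by
        exact_mod_cast (Nat.factorial_pos _).trans_le (factorial_half_le_factorialSpeed n)
      have hlog : 0 < Real.log n := Real.log_pos (by exact_mod_cast hn)
      rw [add_sub_cancel, Real.rpow_def_of_pos (by positivity), mul_div_cancel₀ _ hlog.ne',
        Real.exp_log hpos]

end OrderedGraph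

theorem mainTheorem8 (P : Set OrderedGraph) (hP : OrderedGraph.IsHereditary P)
    (f : ℕ → ℕ)
    (hf : (fun n : ℕ => (f n : ℝ)) =o[atTop] (fun n : ℕ => (n : ℝ) ^ 2))
    (hedges : ∀ n : ℕ, ∀ G ∈ P, G.numVertices = n → G.numEdges ≤ f n)
    (hspeed : ∀ c : ℝ, 0 < c → ∃ N : ℕ, c ^ N < (OrderedGraph.speed P N : ℝ)) :
    (∀ n : ℕ, OrderedGraph.factorialSpeed n ≤ OrderedGraph.speed P n) ∧
      ∃ ε : ℕ → ℝ, ε =o[atTop] (fun n : ℕ => (n : ℝ)) ∧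
        ∀ n : ℕ, 1 ≤ n →
          (OrderedGraph.factorialSpeed n : ℝ) = (n : ℝ) ^ ((n : ℝ) / 2 + ε n) := by
  exact ⟨OrderedGraph.factorialSpeed_le_speed hP
    fun _ σ => OrderedGraph.matchingGraph_mem hP hf hedges hspeed σ,
    OrderedGraph.exists_factorialSpeed_eq_rpow⟩
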